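/- **Theorem 5.1.** Let $\bar M$ be an $(LCS)_n$-manifold, that is, a smooth $n$-dimensional manifold with a Lorentzian metric $g$ of signature $(-,+,\dots,+)$ and Levi-Civita connection $\bar\nabla$, a smooth vector field $\xi$ with $g(\xi,\xi)=-1$ and a nowhere vanishing smooth function $\alpha$ such that, with $\eta(X)=g(X,\xi)$, $$(\bar\nabla_X\eta)(Y)=\alpha\{g(X,Y)+\eta(X)\eta(Y)\},\qquad X\alpha=\rho\,\eta(X),\quad \rho=-(\xi\alpha),$$ for all vector fields $X,Y$. The structure tensor is $\phi X=\frac1\alpha\bar\nabla_X\xi$. Let $(M_1,g_1)$ and $(M_2,g_2)$ be non-empty semi-Riemannian manifolds with $\dim M_2\ge 1$, and let $f:M_1\to(0,\infty)$ be smooth. The warped product $M_1\times_f M_2$ is $M_1\times M_2$ with the metric $g_1+f^2g_2$; it is a submanifold of $\bar M$ if it is isometrically immersed in $\bar M$. Write $\mathcal D_1=TM_1$ and $\mathcal D_2=TM_2$ for the distributions tangent to the two factors. A distribution $\mathcal D$ on the submanifold is slant with slant angle $\theta\in[0,\pi/2]$ if for every point $p$ and every $X\in\mathcal D_p$ with $\phi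 X\ne0$ the angle between $\phi X$ and $\mathcal D_p$ (the angle whose cosine is $\|w\|/\|\phi X\|$, $w$ being the orthogonal projection of $\phi X$ on $\mathcal D_p$) equals $\theta$. The submanifold is proper bi-slant if $TM=\mathcal D_1\oplus\mathcal D_2$ orthogonally, $\phi\mathcal D_1\perp\mathcal D_2$, $\phi\mathcal D_2\perp\mathcal D_1$, and $\mathcal D_1,\mathcal D_2$ are slant with slant angles $\theta_1,\theta_2\notin\{0,\pi/2\}$. Then no warped product $M=M_1\times_f M_2$ (for any $g_1,g_2$ and any $f$, constant or not) is a proper bi-slant submanifold of $\bar M$ with $\xi$ tangent to $M_1$. -/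

import Mathlib

open scoped Manifold ContDiff Bundle

noncomputable section

namespace LCS

/-- A smooth semi-Riemannian metric on a manifold: a smooth field of symmetric nondegenerate
bilinear forms on the tangent spaces. -/
structure SemiRiemannianMetric {E : Type*} [NormedAddCommGroup E] [NormedSpace ℝ E]
    {H : Type*} [TopologicalSpace H] (I : ModelWithCorners ℝ E H)
    (M : Type*) [TopologicalSpace M] [ChartedSpace H M] [IsManifold I ∞ M] where
  val : ∀ p : M, TangentSpace I p →L[ℝ] TangentSpace I p →L[ℝ] ℝ
  symm : ∀ (p : M) (u v : TangentSpace I p), val p u v = val p v u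
  nondegenerate : ∀ (p : M) (u : TangentSpace I p),
    (∀ v : TangentSpace I p, val p u v = 0) → u = 0
  contMDiff : ContMDiff I (I.prod 𝓘(ℝ, E →L[ℝ] E →L[ℝ] ℝ)) ∞
    (fun p ↦ Bundle.TotalSpace.mk' (E →L[ℝ] E →L[ℝ] ℝ)
      (E := fun q : M ↦ TangentSpace I q →L[ℝ] TangentSpace I q →L[ℝ] ℝ) p (val p))

section Ambient

variable {E : Type*} [NormedAddCommGroup E] [NormedSpace ℝ E]
  {H : Type*} [TopologicalSpace H] {I : ModelWithCorners ℝ E H}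
  {M : Type*} [TopologicalSpace M] [ChartedSpace H M] [IsManifold I ∞ M]

/-- The metric has signature `(-, +, …, +)`: each tangent space contains a timelike vector whose
orthogonal complement is positive definite. -/
def SemiRiemannianMetric.IsLorentzian (g : SemiRiemannianMetric I M) : Prop :=
  ∀ p : M, ∃ u : TangentSpace I p, g.val p u u < 0 ∧
    ∀ v : TangentSpace I p, g.val p u v = 0 → v ≠ 0 → 0 < g.val p v v

/-- `nabla` is the Levi-Civita connection of `g`: it is torsion free and
`X (g(Y, Z)) = g(∇_X Y, Z) + g(Y, ∇_X Z)`.  (In Mathlib, `nabla Y p u` is `∇_u Y` at `p`.) -/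
structure IsLeviCivita [FiniteDimensional ℝ E] (g : SemiRiemannianMetric I M)
    (nabla : CovariantDerivative I E (TangentSpace I : M → Type _)) : Prop where
  torsion_free : nabla.torsion = 0
  metric : ∀ (p : M) (u : TangentSpace I p) (Y Z : ∀ q : M, TangentSpace I q),
    MDifferentiableAt I I.tangent (fun q ↦ (⟨q, Y q⟩ : TangentBundle I M)) p →
    MDifferentiableAt I I.tangent (fun q ↦ (⟨q, Z q⟩ : TangentBundle I M)) p →
    mvfderiv I (fun q ↦ g.val q (Y q) (Z q)) p u
      = g.val p (nabla Y p u) (Z p) + g.val p (Y p) (nabla Z p u)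

/-- `w` is the `g`-orthogonal projection of the tangent vector `v` on the subspace `W`. -/
def IsOrthogonalProjection (g : SemiRiemannianMetric I M) (p : M)
    (W : Submodule ℝ (TangentSpace I p)) (v w : TangentSpace I p) : Prop :=
  w ∈ W ∧ ∀ z ∈ W, g.val p (v - w) z = 0

/-- The angle between a spacelike vector `v` and a subspace `W` is `θ`: the projection `w` of `v`
on `W` satisfies `cos θ = ‖w‖ / ‖v‖` with `θ ∈ [0, π/2]`. -/
def IsAngle (g : SemiRiemannianMetric I M) (p : M)
    (v : TangentSpace I p) (W : Submodule ℝ (TangentSpace I p)) (θ : ℝ) : Prop :=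
  ∃ w : TangentSpace I p, IsOrthogonalProjection g p W v w ∧
    θ = Real.arccos (Real.sqrt (g.val p w w) / Real.sqrt (g.val p v v))

end Ambient

/-- A Lorentzian concircular structure on an `n`-dimensional manifold: a Lorentzian metric `g` with
its Levi-Civita connection, a unit timelike vector field `ξ` and a nowhere vanishing function `α`
such that, with `η = g(·, ξ)`, one has `(∇_X η)(Y) = α (g(X, Y) + η(X) η(Y))` and
`X α = ρ η(X)` where `ρ = -(ξ α)`.  The structure tensor is defined below from these data. -/
structure LCSManifold (n : ℕ) (M : Type*) [TopologicalSpace M]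
    [ChartedSpace (EuclideanSpace ℝ (Fin n)) M] [IsManifold (𝓡 n) ∞ M] where
  g : SemiRiemannianMetric (𝓡 n) M
  lorentzian : g.IsLorentzian
  nabla : CovariantDerivative (𝓡 n) (EuclideanSpace ℝ (Fin n))
    (TangentSpace (𝓡 n) : M → Type _)
  leviCivita : IsLeviCivita g nabla
  ξ : ∀ p : M, TangentSpace (𝓡 n) p
  ξ_smooth : ContMDiff (𝓡 n) (𝓡 n).tangent ∞ (fun p ↦ (⟨p, ξ p⟩ : TangentBundle (𝓡 n) M))
  unit_timelike : ∀ p, g.val p (ξ p) (ξ p) = -1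
  α : M → ℝ
  α_smooth : ContMDiff (𝓡 n) 𝓘(ℝ, ℝ) ∞ α
  α_ne_zero : ∀ p, α p ≠ 0
  /-- `(∇_u η)(Y) = u (η(Y)) - η(∇_u Y)`. -/
  concircular : ∀ (p : M) (u : TangentSpace (𝓡 n) p) (Y : ∀ q : M, TangentSpace (𝓡 n) q),
    MDifferentiableAt (𝓡 n) (𝓡 n).tangent
      (fun q ↦ (⟨q, Y q⟩ : TangentBundle (𝓡 n) M)) p →
    mvfderiv (𝓡 n) (fun q ↦ g.val q (Y q) (ξ q)) p u - g.val p (nabla Y p u) (ξ p)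
      = α p * (g.val p u (Y p) + g.val p u (ξ p) * g.val p (Y p) (ξ p))
  dα_eq : ∀ (p : M) (u : TangentSpace (𝓡 n) p),
    mvfderiv (𝓡 n) α p u = -(mvfderiv (𝓡 n) α p (ξ p)) * g.val p u (ξ p)

section Submanifold

variable {n : ℕ} {N : Type*} [TopologicalSpace N]
  [ChartedSpace (EuclideanSpace ℝ (Fin n)) N] [IsManifold (𝓡 n) ∞ N]

/-- The structure tensor `φ X = (1/α) ∇_X ξ`. -/
def LCSManifold.φ (S : LCSManifold n N) (p : N) :
    TangentSpace (𝓡 n) p →L[ℝ] TangentSpace (𝓡 n) p :=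
  (S.α p)⁻¹ • S.nabla S.ξ p

variable {E : Type*} [NormedAddCommGroup E] [NormedSpace ℝ E]
  {H : Type*} [TopologicalSpace H] {I : ModelWithCorners ℝ E H}
  {M : Type*} [TopologicalSpace M] [ChartedSpace H M]

/-- The distribution `D` on the immersed submanifold `ι : M → N` is slant with slant angle `θ`:
at every point and for every `X` in `D`, the angle between `φ X` and `D` is `θ`.  The angle is
meaningless when `φ X = 0`, that is, when `X` is proportional to `ξ`; such `X` are excluded. -/
def IsSlant (S : LCSManifold n N) (ι : M → N)
    (D : ∀ p : M, Submodule ℝ (TangentSpace I p)) (θ : ℝ) : Prop :=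
  ∀ p : M, ∀ X ∈ D p, S.φ (ι p) (mfderiv I (𝓡 n) ι p X) ≠ 0 →
    IsAngle S.g (ι p) (S.φ (ι p) (mfderiv I (𝓡 n) ι p X))
      ((D p).map (mfderiv I (𝓡 n) ι p).toLinearMap) θ

/-- The immersed submanifold `ι : M → N` is bi-slant with respect to the distributions `D₁`, `D₂`,
with slant angles `θ₁`, `θ₂`. -/
structure IsBiSlant (S : LCSManifold n N) (ι : M → N)
    (D₁ D₂ : ∀ p : M, Submodule ℝ (TangentSpace I p)) (θ₁ θ₂ : ℝ) : Prop where
  orthogonal : ∀ p : M, ∀ X ∈ D₁ p, ∀ Y ∈ D₂ p,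
    S.g.val (ι p) (mfderiv I (𝓡 n) ι p X) (mfderiv I (𝓡 n) ι p Y) = 0
  direct_sum : ∀ p : M, IsCompl (D₁ p) (D₂ p)
  φD₁_orthogonal : ∀ p : M, ∀ X ∈ D₁ p, ∀ Y ∈ D₂ p,
    S.g.val (ι p) (S.φ (ι p) (mfderiv I (𝓡 n) ι p X)) (mfderiv I (𝓡 n) ι p Y) = 0
  φD₂_orthogonal : ∀ p : M, ∀ X ∈ D₁ p, ∀ Y ∈ D₂ p,
    S.g.val (ι p) (S.φ (ι p) (mfderiv I (𝓡 n) ι p Y)) (mfderiv I (𝓡 n) ι p X) = 0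
  slant₁ : IsSlant S ι D₁ θ₁
  slant₂ : IsSlant S ι D₂ θ₂

/-- Bi-slant with both slant angles different from `0` and `π/2`. -/
def IsProperBiSlant (S : LCSManifold n N) (ι : M → N)
    (D₁ D₂ : ∀ p : M, Submodule ℝ (TangentSpace I p)) : Prop :=
  ∃ θ₁ θ₂ : ℝ, IsBiSlant S ι D₁ D₂ θ₁ θ₂ ∧
    θ₁ ≠ 0 ∧ θ₁ ≠ Real.pi / 2 ∧ θ₂ ≠ 0 ∧ θ₂ ≠ Real.pi / 2

end Submanifold

section WarpedProduct

/-- The distribution `TM₁` on `M₁ × M₂`: vectors tangent to the slices `M₁ × {p₂}`. -/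
def factor₁ (m₁ m₂ : ℕ)
    {M₁ : Type*} [TopologicalSpace M₁] [ChartedSpace (EuclideanSpace ℝ (Fin m₁)) M₁]
    {M₂ : Type*} [TopologicalSpace M₂] [ChartedSpace (EuclideanSpace ℝ (Fin m₂)) M₂]
    (p : M₁ × M₂) : Submodule ℝ (TangentSpace ((𝓡 m₁).prod (𝓡 m₂)) p) :=
  (mfderiv ((𝓡 m₁).prod (𝓡 m₂)) (𝓡 m₂) (Prod.snd : M₁ × M₂ → M₂) p).ker

/-- The distribution `TM₂` on `M₁ × M₂`: vectors tangent to the slices `{p₁} × M₂`. -/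
def factor₂ (m₁ m₂ : ℕ)
    {M₁ : Type*} [TopologicalSpace M₁] [ChartedSpace (EuclideanSpace ℝ (Fin m₁)) M₁]
    {M₂ : Type*} [TopologicalSpace M₂] [ChartedSpace (EuclideanSpace ℝ (Fin m₂)) M₂]
    (p : M₁ × M₂) : Submodule ℝ (TangentSpace ((𝓡 m₁).prod (𝓡 m₂)) p) :=
  (mfderiv ((𝓡 m₁).prod (𝓡 m₂)) (𝓡 m₁) (Prod.fst : M₁ × M₂ → M₁) p).ker

variable {m₁ m₂ : ℕ}
  {M₁ : Type*} [TopologicalSpace M₁] [ChartedSpace (EuclideanSpace ℝ (Fin m₁)) M₁]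
  [IsManifold (𝓡 m₁) ∞ M₁]
  {M₂ : Type*} [TopologicalSpace M₂] [ChartedSpace (EuclideanSpace ℝ (Fin m₂)) M₂]
  [IsManifold (𝓡 m₂) ∞ M₂]

/-- The warped product metric `g₁ + f² g₂` on `M₁ × M₂`, with the pullbacks by the projections
understood. -/
def warpedMetric (g₁ : SemiRiemannianMetric (𝓡 m₁) M₁) (g₂ : SemiRiemannianMetric (𝓡 m₂) M₂)
    (f : M₁ → ℝ) (p : M₁ × M₂) (u v : TangentSpace ((𝓡 m₁).prod (𝓡 m₂)) p) : ℝ :=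
  g₁.val p.1 (mfderiv ((𝓡 m₁).prod (𝓡 m₂)) (𝓡 m₁) Prod.fst p u)
      (mfderiv ((𝓡 m₁).prod (𝓡 m₂)) (𝓡 m₁) Prod.fst p v)
    + f p.1 ^ 2 * g₂.val p.2 (mfderiv ((𝓡 m₁).prod (𝓡 m₂)) (𝓡 m₂) Prod.snd p u)
      (mfderiv ((𝓡 m₁).prod (𝓡 m₂)) (𝓡 m₂) Prod.snd p v)

variable {n : ℕ} {N : Type*} [TopologicalSpace N]
  [ChartedSpace (EuclideanSpace ℝ (Fin n)) N] [IsManifold (𝓡 n) ∞ N]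

/-- `ι` makes the warped product `M₁ ×_f M₂` an (immersed) submanifold of `N`, the metric induced
by that of `N` being the warped product metric. -/
structure IsWarpedProductSubmanifold (S : LCSManifold n N)
    (g₁ : SemiRiemannianMetric (𝓡 m₁) M₁) (g₂ : SemiRiemannianMetric (𝓡 m₂) M₂)
    (f : M₁ → ℝ) (ι : M₁ × M₂ → N) : Prop where
  f_smooth : ContMDiff (𝓡 m₁) 𝓘(ℝ, ℝ) ∞ f
  f_pos : ∀ p, 0 < f p
  immersion : Manifold.IsImmersion ((𝓡 m₁).prod (𝓡 m₂)) (𝓡 n) ∞ ι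
  isometric : ∀ (p : M₁ × M₂) (u v : TangentSpace ((𝓡 m₁).prod (𝓡 m₂)) p),
    S.g.val (ι p) (mfderiv ((𝓡 m₁).prod (𝓡 m₂)) (𝓡 n) ι p u)
        (mfderiv ((𝓡 m₁).prod (𝓡 m₂)) (𝓡 n) ι p v)
      = warpedMetric g₁ g₂ f p u v

/-- Along the submanifold, `ξ` is tangent to `M₁`. -/
def IsTangentToFactor₁ (m₁ m₂ : ℕ)
    {M₁ : Type*} [TopologicalSpace M₁] [ChartedSpace (EuclideanSpace ℝ (Fin m₁)) M₁]
    {M₂ : Type*} [TopologicalSpace M₂] [ChartedSpace (EuclideanSpace ℝ (Fin m₂)) M₂]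
    (S : LCSManifold n N) (ι : M₁ × M₂ → N) : Prop :=
  ∀ p : M₁ × M₂, ∃ X ∈ factor₁ m₁ m₂ p,
    mfderiv ((𝓡 m₁).prod (𝓡 m₂)) (𝓡 n) ι p X = S.ξ (ι p)

end WarpedProduct

end LCS

end

/-!
On an `(LCS)ₙ`-manifold the structure tensor is explicit. Metricity of the connection turns the
concircular equation into `g(Y, ∇_X ξ) = α (g(X, Y) + η(X) η(Y))` for all `Y`, so nondegeneracy
gives `∇_X ξ = α (X + η(X) ξ)`, that is, `φ X = X + η(X) ξ` (`LCS.LCSManifold.φ_apply`). In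
particular `φ` is the identity on the orthogonal complement of `ξ`.

If `ξ` is tangent to `M₁`, then `TM₂` is orthogonal to `ξ`, so `φ X = X` for every `X` tangent to
`M₂`. Since `ξ` is timelike and the metric is Lorentzian, its orthogonal complement is positive
definite (`LCS.SemiRiemannianMetric.IsLorentzian.pos_of_orthogonal_timelike`), and hence the
projection of `φ X = X` on `TM₂` is `X` itself and has positive length. The slant angle of `TM₂` is
therefore `arccos 1 = 0`, which properness excludes. A nonzero `X` exists because `dim M₂ ≥ 1`, and
it stays nonzero in the ambient manifold because the induced metric is the warped product metric,
which is nondegenerate along `M₂` as `f > 0`.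
-/

open scoped Manifold ContDiff Bundle

namespace LCS

section Ambient

variable {E : Type*} [NormedAddCommGroup E] [NormedSpace ℝ E]
  {H : Type*} [TopologicalSpace H] {I : ModelWithCorners ℝ E H}
  {M : Type*} [TopologicalSpace M] [ChartedSpace H M] [IsManifold I ∞ M]

/-- In a Lorentzian tangent space the orthogonal complement of any timelike vector `ξ` is positive
definite. If `g(v, v) ≤ 0`, the metric would be negative semidefinite on the span of `ξ` and `v`,
whereas that plane meets the positive definite hyperplane given by the signature condition. -/
theorem SemiRiemannianMetric.IsLorentzian.pos_of_orthogonal_timelike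
    {g : SemiRiemannianMetric I M} (hg : g.IsLorentzian) {p : M} {ξ v : TangentSpace I p}
    (hξ : g.val p ξ ξ < 0) (hv : g.val p ξ v = 0) (hv0 : v ≠ 0) : 0 < g.val p v v := by
  obtain ⟨u, -, hpos⟩ := hg p
  by_contra! hle
  have hvξ : g.val p v ξ = 0 := by rw [g.symm, hv]
  have huξ : g.val p u ξ ≠ 0 := by
    intro h
    have := hpos ξ h (by rintro rfl; simp at hξ)
    linarith
  -- This combination of `ξ` and `v` is orthogonal to `u`.
  have hw := hpos (g.val p u v • ξ - g.val p u ξ • v)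
    (by simp only [map_sub, map_smul, smul_eq_mul]; ring)
  have hne : g.val p u v • ξ - g.val p u ξ • v ≠ 0 := by
    intro h
    have h1 := congrArg (g.val p ξ) h
    simp only [map_sub, map_smul, smul_eq_mul, map_zero, hv, mul_zero, sub_zero] at h1
    have h2 : g.val p u v = 0 := (mul_eq_zero.mp h1).resolve_right hξ.ne
    rw [h2, zero_smul, zero_sub, neg_eq_zero] at h
    exact (smul_ne_zero huξ hv0) h
  have h := hw hne
  simp only [map_sub, map_smul, sub_apply, smul_apply,
    smul_eq_mul, hv, hvξ] at h
  nlinarith [mul_nonneg (sq_nonneg (g.val p u v)) (neg_nonneg.mpr hξ.le),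
    mul_nonneg (sq_nonneg (g.val p u ξ)) (neg_nonneg.mpr hle)]

/-- A spacelike vector of a subspace on which the metric is anisotropic makes the angle `0` with
that subspace. -/
theorem IsAngle.eq_zero_of_mem {g : SemiRiemannianMetric I M} {p : M}
    {W : Submodule ℝ (TangentSpace I p)} {v : TangentSpace I p} {θ : ℝ}
    (h : IsAngle g p v W θ) (hv : v ∈ W) (hvv : 0 < g.val p v v)
    (hW : ∀ z ∈ W, g.val p z z = 0 → z = 0) : θ = 0 := by
  obtain ⟨w, ⟨hw, hproj⟩, rfl⟩ := h
  have hmem : v - w ∈ W := W.sub_mem hv hw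
  obtain rfl : v = w := sub_eq_zero.mp (hW _ hmem (hproj _ hmem))
  rw [div_self (Real.sqrt_pos.mpr hvv).ne', Real.arccos_one]

end Ambient

section StructureTensor

variable {n : ℕ} {N : Type*} [TopologicalSpace N]
  [ChartedSpace (EuclideanSpace ℝ (Fin n)) N] [IsManifold (𝓡 n) ∞ N]

theorem LCSManifold.nabla_ξ (S : LCSManifold n N) (p : N) (u : TangentSpace (𝓡 n) p) :
    S.nabla S.ξ p u = S.α p • (u + S.g.val p u (S.ξ p) • S.ξ p) := by
  rw [← sub_eq_zero]
  refine S.g.nondegenerate p _ fun y ↦ ?_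
  -- The concircular equation is about vector fields, so `y` has to be extended locally.
  have hY := FiberBundle.mdifferentiableAt_extend (𝓡 n) (EuclideanSpace ℝ (Fin n)) y
  have hξ := (S.ξ_smooth p).mdifferentiableAt (by simp)
  have hmetric := S.leviCivita.metric p u _ S.ξ hY hξ
  have hconc := S.concircular p u _ hY
  rw [hmetric] at hconc
  simp only [FiberBundle.extend_apply_self] at hconc
  rw [S.g.symm p (S.nabla S.ξ p u - _) y]
  simp only [map_sub, map_smul, map_add, smul_eq_mul]
  rw [S.g.symm p u y] at hconc
  linarith

/-- On an `(LCS)ₙ`-manifold the structure tensor is `φ X = X + η(X) ξ`. -/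
theorem LCSManifold.φ_apply (S : LCSManifold n N) (p : N) (u : TangentSpace (𝓡 n) p) :
    S.φ p u = u + S.g.val p u (S.ξ p) • S.ξ p := by
  rw [LCSManifold.φ, smul_apply, S.nabla_ξ, smul_smul,
    inv_mul_cancel₀ (S.α_ne_zero p), one_smul]

end StructureTensor

section WarpedProduct

variable {m₁ m₂ : ℕ}
  {M₁ : Type*} [TopologicalSpace M₁] [ChartedSpace (EuclideanSpace ℝ (Fin m₁)) M₁]
  {M₂ : Type*} [TopologicalSpace M₂] [ChartedSpace (EuclideanSpace ℝ (Fin m₂)) M₂]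

theorem exists_mem_factor₂_mfderiv_snd_ne_zero (hm₂ : 0 < m₂) (p : M₁ × M₂) :
    ∃ X ∈ factor₂ m₁ m₂ p,
      mfderiv ((𝓡 m₁).prod (𝓡 m₂)) (𝓡 m₂) (Prod.snd : M₁ × M₂ → M₂) p X ≠ 0 := by
  refine ⟨((0, EuclideanSpace.single ⟨0, hm₂⟩ 1) :
    EuclideanSpace ℝ (Fin m₁) × EuclideanSpace ℝ (Fin m₂)), ?_, ?_⟩
  · rw [factor₂, mfderiv_fst]
    rfl
  · rw [mfderiv_snd]
    change (EuclideanSpace.single (⟨0, hm₂⟩ : Fin m₂) (1 : ℝ)) ≠ 0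
    simp

variable [IsManifold (𝓡 m₁) ∞ M₁] [IsManifold (𝓡 m₂) ∞ M₂]
  {n : ℕ} {N : Type*} [TopologicalSpace N]
  [ChartedSpace (EuclideanSpace ℝ (Fin n)) N] [IsManifold (𝓡 n) ∞ N]

/-- Isometry and nondegeneracy of `g₂` keep vectors tangent to `M₂` nonzero in the ambient
manifold. -/
theorem IsWarpedProductSubmanifold.mfderiv_ne_zero {S : LCSManifold n N}
    {g₁ : SemiRiemannianMetric (𝓡 m₁) M₁} {g₂ : SemiRiemannianMetric (𝓡 m₂) M₂}
    {f : M₁ → ℝ} {ι : M₁ × M₂ → N} (h : IsWarpedProductSubmanifold S g₁ g₂ f ι) {p : M₁ × M₂}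
    {X : TangentSpace ((𝓡 m₁).prod (𝓡 m₂)) p} (hX : X ∈ factor₂ m₁ m₂ p)
    (hX0 : mfderiv ((𝓡 m₁).prod (𝓡 m₂)) (𝓡 m₂) (Prod.snd : M₁ × M₂ → M₂) p X ≠ 0) :
    mfderiv ((𝓡 m₁).prod (𝓡 m₂)) (𝓡 n) ι p X ≠ 0 := by
  intro h0
  refine hX0 (g₂.nondegenerate p.2 _ fun y ↦ ?_)
  have hfst : mfderiv ((𝓡 m₁).prod (𝓡 m₂)) (𝓡 m₁) (Prod.fst : M₁ × M₂ → M₁) p X = 0 := hX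
  obtain ⟨Y, rfl⟩ : ∃ Y : TangentSpace ((𝓡 m₁).prod (𝓡 m₂)) p,
      mfderiv ((𝓡 m₁).prod (𝓡 m₂)) (𝓡 m₂) (Prod.snd : M₁ × M₂ → M₂) p Y = y := by
    refine ⟨((0, y) : EuclideanSpace ℝ (Fin m₁) × EuclideanSpace ℝ (Fin m₂)), ?_⟩
    rw [mfderiv_snd]
    rfl
  have hiso := h.isometric p X Y
  unfold warpedMetric at hiso
  rw [h0, hfst] at hiso
  simp only [map_zero, zero_apply, zero_add] at hiso
  exact (mul_eq_zero.mp hiso.symm).resolve_left (pow_ne_zero 2 (h.f_pos p.1).ne')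

end WarpedProduct

end LCS

theorem theorem5p1 {n m₁ m₂ : ℕ} (hm₂ : 0 < m₂)
    {N : Type*} [TopologicalSpace N] [ChartedSpace (EuclideanSpace ℝ (Fin n)) N]
    [IsManifold (𝓡 n) ∞ N]
    {M₁ : Type*} [TopologicalSpace M₁] [ChartedSpace (EuclideanSpace ℝ (Fin m₁)) M₁]
    [IsManifold (𝓡 m₁) ∞ M₁] [Nonempty M₁]
    {M₂ : Type*} [TopologicalSpace M₂] [ChartedSpace (EuclideanSpace ℝ (Fin m₂)) M₂]
    [IsManifold (𝓡 m₂) ∞ M₂] [Nonempty M₂]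
    (S : LCS.LCSManifold n N) :
    ¬ ∃ (g₁ : LCS.SemiRiemannianMetric (𝓡 m₁) M₁) (g₂ : LCS.SemiRiemannianMetric (𝓡 m₂) M₂)
        (f : M₁ → ℝ) (ι : M₁ × M₂ → N),
      LCS.IsWarpedProductSubmanifold S g₁ g₂ f ι ∧
      LCS.IsTangentToFactor₁ m₁ m₂ S ι ∧
      LCS.IsProperBiSlant S ι (LCS.factor₁ m₁ m₂) (LCS.factor₂ m₁ m₂) := by
  rintro ⟨g₁, g₂, f, ι, hwarp, hξ, θ₁, θ₂, hslant, -, -, hθ₂, -⟩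
  obtain ⟨p⟩ : Nonempty (M₁ × M₂) := inferInstance
  obtain ⟨X, hX, hX0⟩ := LCS.exists_mem_factor₂_mfderiv_snd_ne_zero (M₁ := M₁) (m₁ := m₁) hm₂ p
  obtain ⟨X₁, hX₁, hX₁ξ⟩ := hξ p
  have hne := hwarp.mfderiv_ne_zero hX hX0
  have horth : ∀ z ∈ (LCS.factor₂ m₁ m₂ p).map
      (mfderiv ((𝓡 m₁).prod (𝓡 m₂)) (𝓡 n) ι p).toLinearMap,
      S.g.val (ι p) (S.ξ (ι p)) z = 0 := by
    rintro _ ⟨Y, hY, rfl⟩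
    rw [← hX₁ξ]
    exact hslant.orthogonal p X₁ hX₁ Y hY
  have hpos : ∀ z ∈ (LCS.factor₂ m₁ m₂ p).map
      (mfderiv ((𝓡 m₁).prod (𝓡 m₂)) (𝓡 n) ι p).toLinearMap,
      z ≠ 0 → 0 < S.g.val (ι p) z z := fun z hz ↦
    S.lorentzian.pos_of_orthogonal_timelike (by rw [S.unit_timelike]; norm_num) (horth z hz)
  have hmem := Submodule.mem_map_of_mem
    (f := (mfderiv ((𝓡 m₁).prod (𝓡 m₂)) (𝓡 n) ι p).toLinearMap) hX
  have hφ : S.φ (ι p) (mfderiv ((𝓡 m₁).prod (𝓡 m₂)) (𝓡 n) ι p X)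
      = mfderiv ((𝓡 m₁).prod (𝓡 m₂)) (𝓡 n) ι p X := by
    have h := horth _ hmem
    rw [S.g.symm] at h
    rw [S.φ_apply]
    erw [h]
    rw [zero_smul, add_zero]
  have hangle := hslant.slant₂ p X hX (by rw [hφ]; exact hne)
  rw [hφ] at hangle
  refine hθ₂ (hangle.eq_zero_of_mem hmem (hpos _ hmem hne) fun z hz hzz ↦ ?_)
  by_contra hz0
  exact (hpos z hz hz0).ne' hzz
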